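/- Setting. Let $T\ge 0$ be an integer. For $t=0,\dots,T$ let $\mathcal S_t\subseteq\mathbb R^{d_{\mathcal S}}$ be a compact state space, $\mathcal A_t\subseteq\mathbb R^{d_{\mathcal A}}$ a nonempty compact control space, and $c_t:\mathcal S_t\times\mathcal A_t\to[0,1]$ a continuous cost. For $t=0,\dots,T-1$ let $\xi_t$ be independent random noises with distributions $P_t$ on (Borel) topological spaces $\Xi_t$, and let $F_t:\mathcal S_t\times\mathcal A_t\times\Xi_t\to\mathcal S_{t+1}$ be continuous. Let $\Pi$ be the set of randomized history-dependent policies $\pi=(\pi_t)_{t=0}^T$, where $\pi_t$ is a probability kernel from the history $H_t=(\xi_0,\dots,\xi_{t-1})$ to $\mathcal A_t$. Under $\pi$ the process is generated by $S_0=s$, $A_t\sim\pi_t(\cdot\mid H_t)$, $S_{t+1}=F_t(S_t,A_t,\xi_t)$. Let $\Theta\subseteq\mathbb R^d$ be bounded and let $f_\theta:\mathbb R\to\mathbb R$ ($\theta\in\Theta$) satisfy, for constants $L_C$ and $L_\Theta$, $|f_\theta(z)-f_\theta(z')|\le L_C|z-z'|$ and $|f_\theta(z)-f_{\theta'}(z)|\le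 L_\Theta\|\theta-\theta'\|$ for all $z,z'\in\mathbb R$ and $\theta,\theta'\in\Theta$. Put $$V_0^{\pi,\theta}(s)=\mathbb E^\pi\Big[f_\theta\Big(\sum_{t=0}^T c_t(S_t,A_t)\Big)\,\Big|\,S_0=s\Big],\qquad \mathcal R^\pi(s)=\inf_{\theta\in\Theta}V_0^{\pi,\theta}(s).$$ Augmented problem. On $\mathcal S_t\times\mathbb R$ put $\tilde c_t^\theta(s,x,a)=f_\theta(x+c_t(s,a))-f_\theta(x)$ and $\tilde F_t(s,x,a,\xi)=(F_t(s,a,\xi),\,x+c_t(s,a))$, and let $$\tilde V_t^\theta(s,x)=\inf_{\pi\in\Pi}\mathbb E^\pi\Big[\sum_{i=t}^T\tilde c_i^\theta(S_i,X_i,A_i)\,\Big|\,S_t=s,\,X_t=x\Big],\qquad \tilde V_{T+1}^\theta\equiv 0,$$ where $(S_{i+1},X_{i+1})=\tilde F_i(S_i,X_i,A_i,\xi_i)$ for $t\le i<T$. Theorem. Fix $s\in\mathcal S_0$ and let $\theta^*\in\Theta$ be an optimal solution of $\min_{\theta\in\Theta}\inf_{\pi\in\Pi}V_0^{\pi,\theta}(s)$.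 Then: (1) For all $t=0,\dots,T$, $s_t\in\mathcal S_t$ and $x_t\in\mathbb R$, the infimum over $\Pi$ defining $\tilde V_t^{\theta^*}(s_t,x_t)$ is attained, and the dynamic programming equation $$\tilde V_t^{\theta^*}(s_t,x_t)=\min_{a\in\mathcal A_t}\Big\{\tilde c_t^{\theta^*}(s_t,x_t,a)+\mathbb E_{\xi_t\sim P_t}\big[\tilde V_{t+1}^{\theta^*}(\tilde F_t(s_t,x_t,a,\xi_t))\big]\Big\}$$ holds, where the expectations are of integrable random variables, the minimum is attained, and the expectation term is absent for $t=T$. (2) The minimum of $\mathcal R^\pi(s)$ over $\pi\in\Pi$ is attained, and $$\min_{\pi\in\Pi}\mathcal R^\pi(s)=\tilde V_0^{\theta^*}(s,0)+f_{\theta^*}(0).$$ (3) There are measurable maps $(s_t,x_t)\mapsto\pi^*_{\theta^*,t}(s_t,x_t)\in\mathcal A_t$, $t=0,\dots,T$, that select a minimizer in the dynamic programming equation for all $t,s_t,x_t$. For every such choice the policy $A_t=\pi^*_{\theta^*,t}(S_t,X_t)$, started from $(S_0,X_0)=(s,0)$, is optimal: it minimizes $\mathcal R^\pi(s)$ over $\pi\in\Pi$.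 -/

import Mathlib

open MeasureTheory ProbabilityTheory

noncomputable section

/-- A finite-horizon stochastic optimal control instance with stages `0, …, T`: nonempty compact
control spaces and compact state spaces in Euclidean spaces, continuous stage costs with values in
`[0, 1]`, continuous transition functions, and the distributions of the (independent) transition
noises `ξ_0, …, ξ_{T-1}`, the noise `ξ_t` taking values in `Ξ t`. -/
structure FiniteSOC (T dS dA : ℕ) (Ξ : Fin T → Type*) [∀ t, TopologicalSpace (Ξ t)]
    [∀ t, MeasurableSpace (Ξ t)] where
  /-- state spaces -/
  S : Fin (T + 1) → Set (EuclideanSpace ℝ (Fin dS))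
  /-- control (action) spaces -/
  A : Fin (T + 1) → Set (EuclideanSpace ℝ (Fin dA))
  /-- stage costs -/
  c : ∀ t : Fin (T + 1), S t → A t → ℝ
  /-- transition functions -/
  F : ∀ t : Fin T, S t.castSucc → A t.castSucc → Ξ t → S t.succ
  /-- noise distributions -/
  P : ∀ t : Fin T, Measure (Ξ t)
  isCompact_S : ∀ t, IsCompact (S t)
  isCompact_A : ∀ t, IsCompact (A t)
  nonempty_A : ∀ t, (A t).Nonempty
  continuous_c : ∀ t, Continuous fun p : S t × A t => c t p.1 p.2
  c_nonneg : ∀ t s a, 0 ≤ c t s a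
  c_le_one : ∀ t s a, c t s a ≤ 1
  continuous_F : ∀ t, Continuous fun p : S t.castSucc × A t.castSucc × Ξ t => F t p.1 p.2.1 p.2.2
  isProbabilityMeasure_P : ∀ t, IsProbabilityMeasure (P t)

namespace FiniteSOC

variable {T dS dA d : ℕ} {Ξ : Fin T → Type*} [∀ t, TopologicalSpace (Ξ t)]
  [∀ t, MeasurableSpace (Ξ t)] (M : FiniteSOC T dS dA Ξ)

instance instIsProbabilityMeasureP (t : Fin T) : IsProbabilityMeasure (M.P t) :=
  M.isProbabilityMeasure_P t

/-! ### Policies and the law of the controlled process -/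

/-- The history `H_t = (ξ_0, …, ξ_{t-1})` available at stage `t`. -/
abbrev History (Ξ : Fin T → Type*) (t : Fin (T + 1)) : Type _ :=
  ∀ j : {j : Fin T // j.castSucc < t}, Ξ j

/-- The history at stage `t` contained in a full noise realization. -/
def historyOf (t : Fin (T + 1)) (ξ : ∀ j, Ξ j) : History Ξ t := fun j => ξ j

/-- Randomized history-dependent policies: for every stage `t` a probability kernel from the
histories `H_t` to the control space. -/
structure Policy where
  kernel : ∀ t : Fin (T + 1), Kernel (History Ξ t) (M.A t)
  isMarkov : ∀ t, IsMarkovKernel (kernel t)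

variable {M}

instance instIsMarkovKernel (π : M.Policy) (t : Fin (T + 1)) : IsMarkovKernel (π.kernel t) :=
  π.isMarkov t

/-- The joint conditional law of the controls `(A_0, …, A_T)` given the noise realization: given
the noise, they are independent with `A_t ∼ π_t(· | ξ_0, …, ξ_{t-1})`. -/
def Policy.actionKernel (π : M.Policy) : Kernel (∀ j, Ξ j) (∀ t, M.A t) where
  toFun ξ := Measure.pi fun t => π.kernel t (historyOf t ξ)
  measurable' := by
    refine Measurable.measure_of_isPiSystem_of_isProbabilityMeasure generateFrom_pi.symm
      isPiSystem_pi ?_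
    rintro _ ⟨u, hu, rfl⟩
    simp only [Measure.pi_pi]
    refine Finset.measurable_prod _ fun t _ => ?_
    have h1 : Measurable (historyOf (Ξ := Ξ) t) :=
      measurable_pi_lambda _ fun j => measurable_pi_apply (j : Fin T)
    exact ((π.kernel t).measurable_coe (hu t (Set.mem_univ t))).comp h1

/-- The joint law, under `π`, of the noises `(ξ_0, …, ξ_{T-1})`, which are independent with
`ξ_t ∼ P_t`, and of the controls `(A_0, …, A_T)`. -/
def Policy.law (π : M.Policy) : Measure ((∀ j, Ξ j) × (∀ t, M.A t)) :=
  (Measure.pi M.P) ⊗ₘ π.actionKernel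

variable (M)

/-- The state trajectory: `S_0 = s` and `S_{t+1} = F_t(S_t, A_t, ξ_t)`. -/
def state (s : M.S 0) (ω : (∀ j, Ξ j) × (∀ t, M.A t)) : ∀ t : Fin (T + 1), M.S t :=
  Fin.induction s fun i y => M.F i y (ω.2 i.castSucc) (ω.1 i)

/-- The total cost `∑_{t=0}^T c_t(S_t, A_t)` from `S_0 = s`. -/
def totalCost (s : M.S 0) (ω : (∀ j, Ξ j) × (∀ t, M.A t)) : ℝ :=
  ∑ t, M.c t (M.state s ω t) (ω.2 t)

/-! ### The risk -/

/-- `V_0^{π,θ}(s) = E^π[f_θ(∑_t c_t(S_t, A_t)) | S_0 = s]`. -/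
def value (f : EuclideanSpace ℝ (Fin d) → ℝ → ℝ) (π : M.Policy) (θ : EuclideanSpace ℝ (Fin d))
    (s : M.S 0) : ℝ :=
  ∫ ω, f θ (M.totalCost s ω) ∂π.law

/-- The risk `R^π(s) = inf_{θ ∈ Θ} E^π[f_θ(∑_t c_t(S_t, A_t)) | S_0 = s]`. -/
def risk (Θ : Set (EuclideanSpace ℝ (Fin d))) (f : EuclideanSpace ℝ (Fin d) → ℝ → ℝ)
    (s : M.S 0) (π : M.Policy) : ℝ :=
  ⨅ θ : Θ, M.value f π θ s

/-! ### The problem on the cost-augmented state space -/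

/-- The augmented stage cost `c̃_t^θ(s, x, a) = f_θ(x + c_t(s, a)) - f_θ(x)`; here `φ` is `f_θ`. -/
def augCost (φ : ℝ → ℝ) (t : Fin (T + 1)) (y : M.S t × ℝ) (a : M.A t) : ℝ :=
  φ (y.2 + M.c t y.1 a) - φ y.2

/-- The augmented transition `F̃_t(s, x, a, ξ) = (F_t(s, a, ξ), x + c_t(s, a))`. -/
def augStep (t : Fin T) (y : M.S t.castSucc × ℝ) (a : M.A t.castSucc) (ξ : Ξ t) :
    M.S t.succ × ℝ :=
  (M.F t y.1 a ξ, y.2 + M.c t.castSucc y.1 a)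

/-- The realized augmented cost `∑_{i=t}^T c̃_i^θ(S_i, X_i, A_i)` of the trajectory with
`(S_t, X_t) = y` and `(S_{i+1}, X_{i+1}) = F̃_i(S_i, X_i, A_i, ξ_i)` for `t ≤ i < T`. It is the
first term of the sum plus the same quantity for stage `t + 1` started at `F̃_t(y, A_t, ξ_t)`. -/
def tailCost (φ : ℝ → ℝ) (ω : (∀ j, Ξ j) × (∀ t, M.A t)) : ∀ t : Fin (T + 1), M.S t × ℝ → ℝ :=
  Fin.reverseInduction (motive := fun t => M.S t × ℝ → ℝ)
    (fun y => M.augCost φ (Fin.last T) y (ω.2 (Fin.last T)))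
    (fun i G y => M.augCost φ i.castSucc y (ω.2 i.castSucc) +
      G (M.augStep i y (ω.2 i.castSucc) (ω.1 i)))

/-- The cost-to-go of a policy:
`E^π[∑_{i=t}^T c̃_i^θ(S_i, X_i, A_i) | (S_t, X_t) = y]`. -/
def costToGo (φ : ℝ → ℝ) (π : M.Policy) (t : Fin (T + 1)) (y : M.S t × ℝ) : ℝ :=
  ∫ ω, M.tailCost φ ω t y ∂π.law

/-- The optimal cost-to-go `Ṽ_t^θ` of the augmented problem. -/
def optCostToGo (φ : ℝ → ℝ) (t : Fin (T + 1)) (y : M.S t × ℝ) : ℝ :=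
  ⨅ π : M.Policy, M.costToGo φ π t y

/-- The expression minimized over the control in the dynamic programming equation:
`c̃_t^θ(y, a) + E_{ξ ∼ P_t}[Ṽ_{t+1}^θ(F̃_t(y, a, ξ))]`, with the convention `Ṽ_{T+1}^θ = 0`. -/
def dpObjective (φ : ℝ → ℝ) (t : Fin (T + 1)) : M.S t × ℝ → M.A t → ℝ :=
  Fin.lastCases (motive := fun t => M.S t × ℝ → M.A t → ℝ)
    (fun y a => M.augCost φ (Fin.last T) y a)
    (fun i y a => M.augCost φ i.castSucc y a +
      ∫ ξ, M.optCostToGo φ i.succ (M.augStep i y a ξ) ∂M.P i) t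

/-! ### Feedback policies on the augmented state space -/

/-- Measurable deterministic feedback rules `(t, S_t, X_t) ↦ A_t`. -/
structure Feedback where
  act : ∀ t : Fin (T + 1), M.S t × ℝ → M.A t
  measurable_act : ∀ t, Measurable (act t)

variable {M}

/-- `g` selects at every stage and every augmented state a control that attains the minimum in the
dynamic programming equation. -/
def Feedback.IsGreedy (g : M.Feedback) (φ : ℝ → ℝ) : Prop :=
  ∀ (t : Fin (T + 1)) (y : M.S t × ℝ) (a : M.A t),
    M.dpObjective φ t y (g.act t y) ≤ M.dpObjective φ t y a

/-- The augmented state `(S_t, X_t)` under the feedback rule `g`, started at `(S_0, X_0) = (s, 0)`,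
as a function of the history. -/
def Feedback.closedLoop (g : M.Feedback) (s : M.S 0) :
    ∀ t : Fin (T + 1), History Ξ t → M.S t × ℝ :=
  Fin.induction (motive := fun t => History Ξ t → M.S t × ℝ)
    (fun _ => (s, 0))
    (fun i p h =>
      let y := p fun j => h ⟨j, j.2.trans i.castSucc_lt_succ⟩
      M.augStep i y (g.act i.castSucc y) (h ⟨i, i.castSucc_lt_succ⟩))

theorem measurable_augStep [∀ t, BorelSpace (Ξ t)] (i : Fin T) :
    Measurable fun p : ((M.S i.castSucc × ℝ) × M.A i.castSucc) × Ξ i =>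
      M.augStep i p.1.1 p.1.2 p.2 := by
  have hF : Measurable (Function.uncurry fun (p : M.S i.castSucc × M.A i.castSucc) (ξ : Ξ i) =>
      M.F i p.1 p.2 ξ) := by
    refine measurable_uncurry_of_continuous_of_measurable (fun ξ => ?_) (fun p => ?_)
    · exact (M.continuous_F i).comp (by fun_prop :
        Continuous fun p : M.S i.castSucc × M.A i.castSucc => (p.1, p.2, ξ))
    · exact ((M.continuous_F i).comp (by fun_prop :
        Continuous fun ξ : Ξ i => (p.1, p.2, ξ))).measurable
  have hc : Measurable fun p : M.S i.castSucc × M.A i.castSucc => M.c i.castSucc p.1 p.2 :=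
    (M.continuous_c i.castSucc).measurable
  refine Measurable.prodMk ?_ ?_
  · exact hF.comp (by fun_prop : Measurable
      fun p : ((M.S i.castSucc × ℝ) × M.A i.castSucc) × Ξ i => ((p.1.1.1, p.1.2), p.2))
  · exact (by fun_prop : Measurable
      fun p : ((M.S i.castSucc × ℝ) × M.A i.castSucc) × Ξ i => p.1.1.2).add
      (hc.comp (by fun_prop : Measurable
        fun p : ((M.S i.castSucc × ℝ) × M.A i.castSucc) × Ξ i => (p.1.1.1, p.1.2)))

theorem Feedback.measurable_closedLoop [∀ t, BorelSpace (Ξ t)] (g : M.Feedback) (s : M.S 0)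
    (t : Fin (T + 1)) : Measurable (g.closedLoop s t) := by
  induction t using Fin.induction with
  | zero => exact measurable_const
  | succ i ih =>
    have h1 : Measurable fun h : History Ξ i.succ => g.closedLoop s i.castSucc
        fun j => h ⟨j, j.2.trans i.castSucc_lt_succ⟩ :=
      ih.comp (measurable_pi_lambda _ fun j => measurable_pi_apply _)
    have h2 : Measurable fun h : History Ξ i.succ => h ⟨i, i.castSucc_lt_succ⟩ :=
      measurable_pi_apply _
    exact (measurable_augStep i).comp
      ((h1.prodMk ((g.measurable_act i.castSucc).comp h1)).prodMk h2)

/-- The (deterministic, history-dependent) policy that starts at `(S_0, X_0) = (s, 0)` and follows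
the feedback rule `g`, i.e. `A_t = g_t(S_t, X_t)`. -/
def Feedback.toPolicy [∀ t, BorelSpace (Ξ t)] (g : M.Feedback) (s : M.S 0) : M.Policy where
  kernel t := Kernel.deterministic (fun h => g.act t (g.closedLoop s t h))
    ((g.measurable_act t).comp (g.measurable_closedLoop s t))
  isMarkov _ := inferInstance

end FiniteSOC

end

/-! Two infima commute, so minimizing the risk amounts to minimizing `value` jointly over policies
and parameters. An optimal `θstar` therefore reduces the problem to the single function `f θstar`,
and any policy optimal for that function is risk-optimal (`risk_bounds`). For fixed `φ = f θ` the
augmented costs telescope to `φ` of the total cost minus `φ 0` (`tailCost_state`), which leaves an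
additive finite-horizon problem in the state `(S_t, X_t)`.

That problem is solved by `bellmanValue`, a backward recursion that does not mention policies.
Backward induction makes it continuous and bounded (`bellmanValue_regular`), so minimizers exist and
can be selected measurably (`exists_measurable_argmin`). It bounds every policy's cost-to-go from
below because `ξ_i` is independent of `(ξ_0, …, ξ_{i-1}, A_0, …, A_i)`
(`Policy.indepFun_past_noise`, `Policy.integral_bellmanValue_le`). Under a greedy feedback each
inequality in this argument becomes an equality (`Policy.costToGo_eq_bellmanValue`). Such a feedback
is an admissible policy because its trajectory is a function of the noise history alone. Hence
`optCostToGo` equals `bellmanValue` and inherits all its properties. -/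

noncomputable section

/-! ### Measurable selection of minimizers over a compact set -/

theorem continuous_iInf_of_compactSpace {Y A : Type*} [TopologicalSpace Y] [TopologicalSpace A]
    [CompactSpace A] {q : Y → A → ℝ} (hq : Continuous ↿q) : Continuous fun y => ⨅ a, q y a := by
  simpa only [sInf_image', Set.image_univ, sInf_range] using isCompact_univ.continuous_sInf hq

theorem isLeast_range_iInf {A : Type*} [TopologicalSpace A] [CompactSpace A] [Nonempty A]
    {q : A → ℝ} (hq : Continuous q) : IsLeast (Set.range q) (⨅ a, q a) :=
  (isCompact_range hq).isLeast_sInf (Set.range_nonempty q)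

/-- A continuous function on `Y × A`, with `A` a compact metric space, has a measurable selector of
minimizers over `A`. The selector is the least minimizer after parametrizing `A` by the Cantor
set. -/
theorem exists_measurable_argmin {Y A : Type*} [TopologicalSpace Y] [MeasurableSpace Y]
    [OpensMeasurableSpace Y] [MetricSpace A] [CompactSpace A] [Nonempty A] [MeasurableSpace A]
    [BorelSpace A] {q : Y → A → ℝ} (hq : Continuous ↿q) :
    ∃ σ : Y → A, Measurable σ ∧ ∀ y a, q y (σ y) ≤ q y a := by
  obtain ⟨e₀, he₀, hsurj₀⟩ := exists_nat_bool_continuous_surjective_of_compact A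
  obtain ⟨e, he, hsurj⟩ : ∃ e : cantorSet → A, Continuous e ∧ Function.Surjective e :=
    ⟨e₀ ∘ cantorSetHomeomorphNatToBool, he₀.comp cantorSetHomeomorphNatToBool.continuous,
      hsurj₀.comp cantorSetHomeomorphNatToBool.surjective⟩
  have : CompactSpace cantorSet := isCompact_iff_compactSpace.mp isCompact_cantorSet
  have hV : Continuous fun y => ⨅ a, q y a := continuous_iInf_of_compactSpace hq
  have hqy : ∀ y, Continuous (q y) := fun y => hq.comp (by fun_prop : Continuous fun a => (y, a))
  have hD : ∀ y, ∃ z, IsLeast {z : cantorSet | q y (e z) ≤ ⨅ a, q y a} z := by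
    intro y
    refine IsCompact.exists_isLeast ?_ ?_
    · exact (isClosed_le ((hqy y).comp he) continuous_const).isCompact
    · obtain ⟨a, ha⟩ := (isLeast_range_iInf (hqy y)).1
      obtain ⟨z, rfl⟩ := hsurj a
      exact ⟨z, ha.le⟩
  choose σ hσ using hD
  have hσm : Measurable fun y => (σ y : ℝ) := by
    -- The least minimizer is at most `r` exactly when some minimizer is. So this set is the
    -- projection along the compact Cantor set of a closed set, hence closed.
    refine measurable_of_Iic fun r => IsClosed.measurableSet ?_
    have hcl : IsClosed ({p : Y × cantorSet | (p.2 : ℝ) ≤ r} ∩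
        {p : Y × cantorSet | q p.1 (e p.2) ≤ ⨅ a, q p.1 a}) := by
      refine (isClosed_le (continuous_subtype_val.comp continuous_snd) continuous_const).inter (isClosed_le ?_ ?_)
      · exact hq.comp (continuous_fst.prodMk (he.comp continuous_snd))
      · exact hV.comp continuous_fst
    convert isClosedMap_fst_of_compactSpace _ hcl using 1
    ext y
    simp only [Set.mem_preimage, Set.mem_Iic, Set.mem_image, Set.mem_inter_iff, Set.mem_ofPred_eq, Prod.exists,
      exists_and_right, exists_eq_right]
    exact ⟨fun h => ⟨σ y, h, (hσ y).1⟩, fun ⟨z, hz, hz'⟩ =>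
      (Subtype.coe_le_coe.mpr ((hσ y).2 hz')).trans hz⟩
  have hσm' : Measurable σ := by
    simpa using hσm.subtype_mk (h := fun y => (σ y).2)
  refine ⟨fun y => e (σ y), he.measurable.comp hσm', fun y a => (hσ y).1.trans ?_⟩
  exact (isLeast_range_iInf (hqy y)).2 ⟨a, rfl⟩

namespace FiniteSOC

variable {T dS dA d : ℕ} {Ξ : Fin T → Type*} [∀ t, TopologicalSpace (Ξ t)]
  [∀ t, MeasurableSpace (Ξ t)] (M : FiniteSOC T dS dA Ξ)

instance instCompactSpaceA (t : Fin (T + 1)) : CompactSpace (M.A t) :=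
  isCompact_iff_compactSpace.mp (M.isCompact_A t)

instance instNonemptyA (t : Fin (T + 1)) : Nonempty (M.A t) := (M.nonempty_A t).to_subtype

/-! ### The Bellman recursion -/

/-- The right-hand side of the dynamic programming equation for arbitrary cost-to-go functions. -/
def bellmanObjective (φ : ℝ → ℝ) (G : ∀ t, M.S t × ℝ → ℝ) (t : Fin (T + 1)) :
    M.S t × ℝ → M.A t → ℝ :=
  Fin.lastCases (motive := fun t => M.S t × ℝ → M.A t → ℝ)
    (fun y a => M.augCost φ (Fin.last T) y a)
    (fun i y a => M.augCost φ i.castSucc y a + ∫ ξ, G i.succ (M.augStep i y a ξ) ∂M.P i) t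

/-- The solution of the dynamic programming equation. -/
def bellmanValue (φ : ℝ → ℝ) : ∀ t, M.S t × ℝ → ℝ :=
  Fin.reverseInduction (motive := fun t => M.S t × ℝ → ℝ)
    (fun y => ⨅ a, M.augCost φ (Fin.last T) y a)
    (fun i G y => ⨅ a, (M.augCost φ i.castSucc y a + ∫ ξ, G (M.augStep i y a ξ) ∂M.P i))

/-- Keeping the continuation function as a parameter allows `optCostToGo` to be replaced by
`bellmanValue` inside the dynamic programming equation once the two are known to agree. -/
theorem dpObjective_eq_bellmanObjective (φ : ℝ → ℝ) :
    M.dpObjective φ = M.bellmanObjective φ (M.optCostToGo φ) := rfl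

theorem bellmanObjective_last (φ : ℝ → ℝ) (G : ∀ t, M.S t × ℝ → ℝ) :
    M.bellmanObjective φ G (Fin.last T) = M.augCost φ (Fin.last T) := by
  simp [bellmanObjective]

theorem bellmanObjective_castSucc (φ : ℝ → ℝ) (G : ∀ t, M.S t × ℝ → ℝ) (i : Fin T)
    (y : M.S i.castSucc × ℝ) (a : M.A i.castSucc) :
    M.bellmanObjective φ G i.castSucc y a =
      M.augCost φ i.castSucc y a + ∫ ξ, G i.succ (M.augStep i y a ξ) ∂M.P i := by
  simp [bellmanObjective]

theorem bellmanValue_eq_iInf (φ : ℝ → ℝ) (t : Fin (T + 1)) (y : M.S t × ℝ) :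
    M.bellmanValue φ t y = ⨅ a, M.bellmanObjective φ (M.bellmanValue φ) t y a := by
  induction t using Fin.lastCases with
  | last => simp [bellmanValue, bellmanObjective_last]
  | cast i => simp [bellmanValue, bellmanObjective_castSucc]

theorem tailCost_last (φ : ℝ → ℝ) (ω : (∀ j, Ξ j) × (∀ t, M.A t)) (y : M.S (Fin.last T) × ℝ) :
    M.tailCost φ ω (Fin.last T) y = M.augCost φ (Fin.last T) y (ω.2 (Fin.last T)) := by
  simp [tailCost]

theorem tailCost_castSucc (φ : ℝ → ℝ) (ω : (∀ j, Ξ j) × (∀ t, M.A t)) (i : Fin T)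
    (y : M.S i.castSucc × ℝ) :
    M.tailCost φ ω i.castSucc y = M.augCost φ i.castSucc y (ω.2 i.castSucc) +
      M.tailCost φ ω i.succ (M.augStep i y (ω.2 i.castSucc) (ω.1 i)) := by
  simp [tailCost]

variable {M} {φ : ℝ → ℝ} {L : ℝ}

theorem continuous_of_abs_sub_le (hφ : ∀ z z', |φ z - φ z'| ≤ L * |z - z'|) : Continuous φ :=
  (LipschitzWith.of_dist_le_mul (K := L.toNNReal) fun z z' => by
    rw [Real.dist_eq, Real.dist_eq]
    exact (hφ z z').trans
      (mul_le_mul_of_nonneg_right (Real.le_coe_toNNReal L) (abs_nonneg _))).continuous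

/-- One stage moves the accumulated cost by at most 1, so the Lipschitz bound is uniform even though
that coordinate ranges over all of `ℝ`. All later integrability and domination rests on this. -/
theorem abs_augCost_le (hφ : ∀ z z', |φ z - φ z'| ≤ L * |z - z'|) (t : Fin (T + 1))
    (y : M.S t × ℝ) (a : M.A t) : |M.augCost φ t y a| ≤ |L| := by
  have h0 := M.c_nonneg t y.1 a
  have h1 := M.c_le_one t y.1 a
  refine (hφ _ _).trans ?_
  rw [add_sub_cancel_left, abs_of_nonneg h0]
  exact (mul_le_mul_of_nonneg_right (le_abs_self L) h0).trans
    (mul_le_of_le_one_right (abs_nonneg L) h1)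

theorem continuous_augCost (hφ : Continuous φ) (t : Fin (T + 1)) :
    Continuous fun p : (M.S t × ℝ) × M.A t => M.augCost φ t p.1 p.2 := by
  have hc : Continuous fun p : (M.S t × ℝ) × M.A t => M.c t p.1.1 p.2 :=
    (M.continuous_c t).comp (by fun_prop : Continuous fun p : (M.S t × ℝ) × M.A t => (p.1.1, p.2))
  unfold augCost
  fun_prop

theorem continuous_augStep (i : Fin T) (ξ : Ξ i) :
    Continuous fun p : (M.S i.castSucc × ℝ) × M.A i.castSucc => M.augStep i p.1 p.2 ξ := by
  have hF := (M.continuous_F i).comp (by fun_prop :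
    Continuous fun p : (M.S i.castSucc × ℝ) × M.A i.castSucc => (p.1.1, p.2, ξ))
  have hc := (M.continuous_c i.castSucc).comp (by fun_prop :
    Continuous fun p : (M.S i.castSucc × ℝ) × M.A i.castSucc => (p.1.1, p.2))
  exact hF.prodMk ((by fun_prop : Continuous fun p : (M.S i.castSucc × ℝ) × M.A i.castSucc =>
    p.1.2).add hc)

/-! ### Realized costs -/

theorem exists_abs_tailCost_le (hφ : ∀ z z', |φ z - φ z'| ≤ L * |z - z'|) (t : Fin (T + 1)) :
    ∃ C, ∀ (ω : (∀ j, Ξ j) × (∀ t, M.A t)) (y : M.S t × ℝ), |M.tailCost φ ω t y| ≤ C := by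
  induction t using Fin.reverseInduction with
  | last =>
    refine ⟨|L|, fun ω y => ?_⟩
    rw [tailCost_last]
    exact abs_augCost_le hφ _ y _
  | cast i ih =>
    obtain ⟨C, hC⟩ := ih
    refine ⟨|L| + C, fun ω y => ?_⟩
    rw [tailCost_castSucc]
    exact (abs_add_le _ _).trans (add_le_add (abs_augCost_le hφ _ y _) (hC _ _))

variable (M) in
theorem state_succ (s : M.S 0) (ω : (∀ j, Ξ j) × (∀ t, M.A t)) (i : Fin T) :
    M.state s ω i.succ = M.F i (M.state s ω i.castSucc) (ω.2 i.castSucc) (ω.1 i) := by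
  simp [state]

/-- The increments of `φ` along the accumulated cost telescope. The induction needs arbitrary `x`,
since each step shifts it by the current stage cost. -/
theorem tailCost_state (s : M.S 0) (ω : (∀ j, Ξ j) × (∀ t, M.A t)) (t : Fin (T + 1)) (x : ℝ) :
    M.tailCost φ ω t (M.state s ω t, x) =
      φ (x + ∑ j ∈ Finset.Ici t, M.c j (M.state s ω j) (ω.2 j)) - φ x := by
  induction t using Fin.reverseInduction generalizing x with
  | last =>
    rw [tailCost_last, show Finset.Ici (Fin.last T) = {Fin.last T} from Finset.Ici_top,
      Finset.sum_singleton]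
    rfl
  | cast i ih =>
    have h1 : Finset.Ici i.castSucc = insert i.castSucc (Finset.Ici i.succ) := by
      ext j
      simp only [Finset.mem_Ici, Finset.mem_insert, Fin.le_def, Fin.ext_iff, Fin.val_castSucc,
        Fin.val_succ]
      omega
    have h2 : i.castSucc ∉ Finset.Ici i.succ := by simp
    rw [tailCost_castSucc, augStep, ← state_succ, ih, h1, Finset.sum_insert h2, augCost, ← add_assoc]
    ring

theorem totalCost_eq_tailCost (s : M.S 0) (ω : (∀ j, Ξ j) × (∀ t, M.A t)) :
    φ (M.totalCost s ω) = M.tailCost φ ω 0 (s, 0) + φ 0 := by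
  have h := tailCost_state (φ := φ) s ω 0 0
  have h0 : M.state s ω 0 = s := rfl
  have h1 : Finset.Ici (0 : Fin (T + 1)) = Finset.univ := by ext; simp
  rw [h0, h1, zero_add] at h
  rw [h, totalCost, sub_add_cancel]

/-! ### Regularity of the Bellman recursion -/

variable [∀ t, BorelSpace (Ξ t)]

theorem measurable_augStep_noise (i : Fin T) (y : M.S i.castSucc × ℝ) (a : M.A i.castSucc) :
    Measurable (M.augStep i y a) :=
  (measurable_augStep i).comp (measurable_const.prodMk measurable_id :
    Measurable fun ξ : Ξ i => ((y, a), ξ))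

/-- Dominated convergence: for fixed noise the integrand is continuous in state and control, and a
bound on the continuation function dominates it. -/
theorem continuous_bellmanObjective_castSucc (hφ : Continuous φ) {G : ∀ t, M.S t × ℝ → ℝ}
    {i : Fin T} (hG : Continuous (G i.succ)) {C : ℝ} (hC : ∀ y, |G i.succ y| ≤ C) :
    Continuous ↿(M.bellmanObjective φ G i.castSucc) := by
  have : Continuous fun p : (M.S i.castSucc × ℝ) × M.A i.castSucc =>
      M.augCost φ i.castSucc p.1 p.2 + ∫ ξ, G i.succ (M.augStep i p.1 p.2 ξ) ∂M.P i := by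
    refine (continuous_augCost hφ _).add (continuous_of_dominated (bound := fun _ => C) ?_ ?_ ?_ ?_)
    · exact fun p => (hG.measurable.comp (measurable_augStep_noise i p.1 p.2)).aestronglyMeasurable
    · exact fun p => .of_forall fun ξ => hC _
    · exact integrable_const _
    · exact .of_forall fun ξ => hG.comp (continuous_augStep i ξ)
  simpa only [Function.HasUncurry.uncurry, id_eq, bellmanObjective_castSucc] using this

/-- The claims are proved together because continuity of the objective at one stage needs both
continuity and boundedness of the value at the next. Compactness of the control space passes both
from objective to value. -/
theorem bellmanValue_regular (hφ : ∀ z z', |φ z - φ z'| ≤ L * |z - z'|) (t : Fin (T + 1)) :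
    Continuous ↿(M.bellmanObjective φ (M.bellmanValue φ) t) ∧ Continuous (M.bellmanValue φ t) ∧
      ∃ C, ∀ y, |M.bellmanValue φ t y| ≤ C := by
  have hφc := continuous_of_abs_sub_le hφ
  have key : ∀ t, Continuous ↿(M.bellmanObjective φ (M.bellmanValue φ) t) →
      (∃ C, ∀ y a, |M.bellmanObjective φ (M.bellmanValue φ) t y a| ≤ C) →
      Continuous ↿(M.bellmanObjective φ (M.bellmanValue φ) t) ∧ Continuous (M.bellmanValue φ t) ∧
        ∃ C, ∀ y, |M.bellmanValue φ t y| ≤ C := by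
    rintro t hc ⟨C, hC⟩
    refine ⟨hc, ?_, C, fun y => ?_⟩
    · rw [funext (M.bellmanValue_eq_iInf φ t)]
      exact continuous_iInf_of_compactSpace hc
    · obtain ⟨a, ha⟩ := (isLeast_range_iInf
        (hc.comp (by fun_prop : Continuous fun a : M.A t => (y, a)))).1
      rw [bellmanValue_eq_iInf]
      exact ha ▸ hC y a
  induction t using Fin.reverseInduction with
  | last =>
    refine key _ ?_ ⟨|L|, fun y a => ?_⟩
    · rw [bellmanObjective_last]
      exact continuous_augCost hφc _
    · rw [bellmanObjective_last]
      exact abs_augCost_le hφ _ y a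
  | cast i ih =>
    obtain ⟨-, hG, C, hC⟩ := ih
    refine key _ (continuous_bellmanObjective_castSucc hφc hG hC) ⟨|L| + C, fun y a => ?_⟩
    rw [bellmanObjective_castSucc]
    refine (abs_add_le _ _).trans (add_le_add (abs_augCost_le hφ _ y a) ?_)
    simpa using norm_integral_le_of_norm_le_const (μ := M.P i)
      (f := fun ξ => M.bellmanValue φ i.succ (M.augStep i y a ξ)) (.of_forall fun ξ => hC _)

theorem isLeast_bellmanValue (hφ : ∀ z z', |φ z - φ z'| ≤ L * |z - z'|) (t : Fin (T + 1))
    (y : M.S t × ℝ) :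
    IsLeast (Set.range fun a => M.bellmanObjective φ (M.bellmanValue φ) t y a)
      (M.bellmanValue φ t y) := by
  rw [bellmanValue_eq_iInf]
  exact isLeast_range_iInf ((bellmanValue_regular hφ t).1.comp
    (by fun_prop : Continuous fun a : M.A t => (y, a)))

theorem exists_feedback_bellman (hφ : ∀ z z', |φ z - φ z'| ≤ L * |z - z'|) :
    ∃ g : M.Feedback, ∀ t y, M.bellmanObjective φ (M.bellmanValue φ) t y (g.act t y) =
      M.bellmanValue φ t y := by
  choose act hact hmin using fun t => exists_measurable_argmin
    (bellmanValue_regular (M := M) hφ t).1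
  refine ⟨⟨act, hact⟩, fun t y => le_antisymm ?_ ?_⟩
  · obtain ⟨a, ha⟩ := (isLeast_bellmanValue hφ t y).1
    exact (hmin t y a).trans ha.le
  · exact (isLeast_bellmanValue hφ t y).2 ⟨_, rfl⟩

theorem integrable_bellmanValue_augStep (hφ : ∀ z z', |φ z - φ z'| ≤ L * |z - z'|) (i : Fin T)
    (y : M.S i.castSucc × ℝ) (a : M.A i.castSucc) :
    Integrable (fun ξ => M.bellmanValue φ i.succ (M.augStep i y a ξ)) (M.P i) := by
  obtain ⟨-, hG, C, hC⟩ := bellmanValue_regular (M := M) hφ i.succ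
  exact .of_bound (hG.measurable.comp (measurable_augStep_noise i y a)).aestronglyMeasurable C
    (.of_forall fun ξ => hC _)

theorem measurable_tailCost (hφ : Continuous φ) (t : Fin (T + 1)) :
    Measurable fun p : ((∀ j, Ξ j) × (∀ t, M.A t)) × (M.S t × ℝ) => M.tailCost φ p.1 t p.2 := by
  induction t using Fin.reverseInduction with
  | last =>
    simp only [tailCost_last]
    exact (continuous_augCost hφ _).measurable.comp (by fun_prop : Measurable
      fun p : ((∀ j, Ξ j) × (∀ t, M.A t)) × (M.S (Fin.last T) × ℝ) => (p.2, p.1.2 (Fin.last T)))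
  | cast i ih =>
    simp only [tailCost_castSucc]
    refine ((continuous_augCost hφ _).measurable.comp (by fun_prop : Measurable
      fun p : ((∀ j, Ξ j) × (∀ t, M.A t)) × (M.S i.castSucc × ℝ) =>
        (p.2, p.1.2 i.castSucc))).add (ih.comp (measurable_fst.prodMk ?_))
    exact (measurable_augStep i).comp (by fun_prop : Measurable
      fun p : ((∀ j, Ξ j) × (∀ t, M.A t)) × (M.S i.castSucc × ℝ) =>
        ((p.2, p.1.2 i.castSucc), p.1.1 i))

end FiniteSOC

namespace FiniteSOC

theorem measurable_historyOf {T : ℕ} {Ξ : Fin T → Type*} [∀ t, MeasurableSpace (Ξ t)]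
    (t : Fin (T + 1)) : Measurable (historyOf (Ξ := Ξ) t) :=
  measurable_pi_lambda _ fun j => measurable_pi_apply (j : Fin T)

variable {T dS dA d : ℕ} {Ξ : Fin T → Type*} [∀ t, TopologicalSpace (Ξ t)]
  [∀ t, MeasurableSpace (Ξ t)] {M : FiniteSOC T dS dA Ξ}

/-! ### The noise is independent of the past -/

instance instIsMarkovKernelActionKernel (π : M.Policy) : IsMarkovKernel π.actionKernel where
  isProbabilityMeasure ξ :=
    inferInstanceAs (IsProbabilityMeasure (Measure.pi fun t => π.kernel t (historyOf t ξ)))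

instance instIsProbabilityMeasureLaw (π : M.Policy) : IsProbabilityMeasure π.law :=
  inferInstanceAs (IsProbabilityMeasure (Measure.pi M.P ⊗ₘ π.actionKernel))

/-- The controls `A_0, …, A_{t-1}`. -/
def controlsOf (t : Fin (T + 1)) (a : ∀ t, M.A t) : ∀ j : {j : Fin (T + 1) // j < t}, M.A j :=
  fun j => a j

theorem measurable_controlsOf (t : Fin (T + 1)) : Measurable (controlsOf (M := M) t) :=
  measurable_pi_lambda _ fun j => measurable_pi_apply (j : Fin (T + 1))

/-- The conditional law of `(A_0, …, A_i)` given the history at stage `i`. -/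
def Policy.controlKernel (π : M.Policy) (i : Fin T) :
    Kernel (History Ξ i.castSucc) (∀ j : {j : Fin (T + 1) // j < i.succ}, M.A j) where
  toFun η := Measure.pi fun j => π.kernel j fun k =>
    η ⟨k, k.2.trans_le (Fin.le_castSucc_iff.mpr j.2)⟩
  measurable' := by
    refine Measurable.measure_of_isPiSystem_of_isProbabilityMeasure generateFrom_pi.symm
      isPiSystem_pi ?_
    rintro _ ⟨u, hu, rfl⟩
    simp only [Measure.pi_pi]
    refine Finset.measurable_prod _ fun j _ => ?_
    exact ((π.kernel j).measurable_coe (hu j (Set.mem_univ j))).comp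
      (measurable_pi_lambda _ fun k => measurable_pi_apply _)

instance instIsMarkovKernelControlKernel (π : M.Policy) (i : Fin T) :
    IsMarkovKernel (π.controlKernel i) where
  isProbabilityMeasure η := inferInstanceAs (IsProbabilityMeasure (Measure.pi
    fun j : {j : Fin (T + 1) // j < i.succ} => π.kernel j fun k =>
      η ⟨k, k.2.trans_le (Fin.le_castSucc_iff.mpr j.2)⟩))

/-- A control at stage `j ≤ i` reads only `ξ_k` with `k < j`, so the marginal of the product law on
these coordinates does not see `ξ_i` or later noises. -/
theorem Policy.actionKernel_map_controlsOf (π : M.Policy) (i : Fin T) (ξ : ∀ j, Ξ j) :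
    (π.actionKernel ξ).map (controlsOf i.succ) = π.controlKernel i (historyOf i.castSucc ξ) :=
  (measurePreserving_fst.comp (measurePreserving_piEquivPiSubtypeProd
    (fun t => π.kernel t (historyOf t ξ)) fun j => j < i.succ)).map_eq

theorem indepFun_historyOf_noise (i : Fin T) :
    IndepFun (historyOf (Ξ := Ξ) i.castSucc) (fun ξ => ξ i) (Measure.pi M.P) := by
  have h := (iIndepFun_pi (μ := M.P) (X := fun _ => id) fun _ => aemeasurable_id).indepFun_finset
    (Finset.univ.filter fun j => j.castSucc < i.castSucc) {i} (by simp) measurable_pi_apply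
  have h1 : Measurable fun (z : ∀ j : {j // j ∈ Finset.univ.filter fun j : Fin T =>
      j.castSucc < i.castSucc}, Ξ j) (j : {j : Fin T // j.castSucc < i.castSucc}) =>
      z ⟨j, Finset.mem_filter.mpr ⟨Finset.mem_univ _, j.2⟩⟩ :=
    measurable_pi_lambda _ fun j => measurable_pi_apply _
  have h2 : Measurable fun z : ∀ j : {j // j ∈ ({i} : Finset (Fin T))}, Ξ j =>
      z ⟨i, Finset.mem_singleton_self i⟩ := measurable_pi_apply _
  exact h.comp h1 h2

theorem Policy.law_map_noise (π : M.Policy) (i : Fin T) : π.law.map (fun ω => ω.1 i) = M.P i := by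
  have h : π.law.map Prod.fst = Measure.pi M.P := Measure.fst_compProd _ _
  rw [← (measurePreserving_eval M.P i).map_eq, ← h, Measure.map_map (measurable_pi_apply i)
    measurable_fst]
  rfl

/-- Under the law of a policy the noise `ξ_i` is independent of `(ξ_0, …, ξ_{i-1}, A_0, …, A_i)`. -/
theorem Policy.indepFun_past_noise (π : M.Policy) (i : Fin T) :
    IndepFun (fun ω : (∀ j, Ξ j) × (∀ t, M.A t) =>
      (historyOf i.castSucc ω.1, controlsOf i.succ ω.2)) (fun ω => ω.1 i) π.law := by
  have key : ∀ s : Set (History Ξ i.castSucc × ∀ j : {j : Fin (T + 1) // j < i.succ}, M.A j),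
      ∀ t : Set (Ξ i), MeasurableSet s → MeasurableSet t →
      π.law ((fun ω => (historyOf i.castSucc ω.1, controlsOf i.succ ω.2)) ⁻¹' s ∩
        (fun ω => ω.1 i) ⁻¹' t) =
      (∫⁻ ξ, π.controlKernel i (historyOf i.castSucc ξ)
        (Prod.mk (historyOf i.castSucc ξ) ⁻¹' s) ∂Measure.pi M.P) * M.P i t := by
    intro s t hs ht
    have hm : Measurable fun ω : (∀ j, Ξ j) × (∀ t, M.A t) =>
        (historyOf i.castSucc ω.1, controlsOf i.succ ω.2) :=
      ((measurable_historyOf _).comp measurable_fst).prodMk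
        ((measurable_controlsOf _).comp measurable_snd)
    have hn : Measurable fun ω : (∀ j, Ξ j) × (∀ t, M.A t) => ω.1 i := by fun_prop
    -- Given the noise, the probability of the past event depends on `ξ_0, …, ξ_{i-1}` only; it is
    -- thus independent of the indicator of `ξ i ∈ t`.
    have hh : Measurable fun η => π.controlKernel i η (Prod.mk η ⁻¹' s) :=
      Kernel.measurable_kernel_prodMk_left hs
    have hind := (indepFun_historyOf_noise (M := M) i).comp hh
      (measurable_const.indicator ht : Measurable (t.indicator fun _ => (1 : ENNReal)))
    have hP : ∫⁻ ξ, t.indicator (fun _ => (1 : ENNReal)) (ξ i) ∂Measure.pi M.P = M.P i t := by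
      rw [(measurePreserving_eval M.P i).lintegral_comp (measurable_const.indicator ht)]
      simp [ht]
    rw [Policy.law, Measure.compProd_apply ((hm hs).inter (hn ht)), ← hP]
    refine Eq.trans ?_ (lintegral_mul_eq_lintegral_mul_lintegral_of_indepFun''
      (hh.comp (measurable_historyOf _)).aemeasurable
      ((measurable_const.indicator ht).comp (measurable_pi_apply i)).aemeasurable hind)
    refine lintegral_congr fun ξ => ?_
    change _ = π.controlKernel i (historyOf i.castSucc ξ) (Prod.mk (historyOf i.castSucc ξ) ⁻¹' s) *
      t.indicator (fun _ => (1 : ENNReal)) (ξ i)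
    by_cases hξ : ξ i ∈ t
    · rw [Set.indicator_of_mem hξ, mul_one, ← π.actionKernel_map_controlsOf,
        Measure.map_apply (measurable_controlsOf _) (measurable_prodMk_left hs)]
      congr 1
      ext a
      simp [hξ]
    · rw [Set.indicator_of_notMem hξ, mul_zero]
      convert measure_empty (μ := π.actionKernel ξ) using 2
      ext a
      simp [hξ]
  refine indepFun_iff_measure_inter_preimage_eq_mul.mpr fun s t hs ht => ?_
  -- Taking one of the two events to be everything identifies each factor of `key` as a marginal
  -- probability.
  have h1 := key s Set.univ hs .univ
  have h2 := key Set.univ t .univ ht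
  simp only [Set.preimage_univ, Set.inter_univ, Set.univ_inter, measure_univ, mul_one,
    lintegral_const, one_mul] at h1 h2
  rw [key s t hs ht, h1, h2]

/-- Independence makes the joint law of `Z` and `ξ_i` a product, so Fubini replaces the realized
noise by a fresh copy. This takes the place of conditional expectations throughout. -/
theorem Policy.integral_noise (π : M.Policy) (i : Fin T) {E : Type*} [MeasurableSpace E]
    {Z : History Ξ i.castSucc × (∀ j : {j : Fin (T + 1) // j < i.succ}, M.A j) → E}
    (hZ : Measurable Z) {G : E × Ξ i → ℝ} (hG : Measurable G) {C : ℝ} (hC : ∀ p, |G p| ≤ C) :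
    ∫ ω, G (Z (historyOf i.castSucc ω.1, controlsOf i.succ ω.2), ω.1 i) ∂π.law =
      ∫ ω, ∫ ξ, G (Z (historyOf i.castSucc ω.1, controlsOf i.succ ω.2), ξ) ∂M.P i ∂π.law := by
  have hm : Measurable fun ω : (∀ j, Ξ j) × (∀ t, M.A t) =>
      Z (historyOf i.castSucc ω.1, controlsOf i.succ ω.2) :=
    hZ.comp (((measurable_historyOf _).comp measurable_fst).prodMk
      ((measurable_controlsOf _).comp measurable_snd))
  have hn : Measurable fun ω : (∀ j, Ξ j) × (∀ t, M.A t) => ω.1 i := by fun_prop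
  have hind := (indepFun_iff_map_prod_eq_prod_map_map hm.aemeasurable hn.aemeasurable).mp
    ((π.indepFun_past_noise i).comp hZ measurable_id)
  rw [π.law_map_noise] at hind
  have : IsProbabilityMeasure (π.law.map fun ω =>
      Z (historyOf i.castSucc ω.1, controlsOf i.succ ω.2)) :=
    Measure.isProbabilityMeasure_map hm.aemeasurable
  rw [← integral_map (hm.prodMk hn).aemeasurable hG.aestronglyMeasurable, hind,
    integral_prod _ (.of_bound hG.aestronglyMeasurable C (.of_forall hC)),
    integral_map hm.aemeasurable hG.stronglyMeasurable.integral_prod_right'.aestronglyMeasurable]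

/-! ### Stage costs and deterministic controls under the law of a policy -/

variable {φ : ℝ → ℝ} {L : ℝ}

theorem Policy.integrable_augCost (hφ : ∀ z z', |φ z - φ z'| ≤ L * |z - z'|) (π : M.Policy)
    (t : Fin (T + 1)) {Y : (∀ j, Ξ j) × (∀ t, M.A t) → M.S t × ℝ} (hY : Measurable Y) :
    Integrable (fun ω => M.augCost φ t (Y ω) (ω.2 t)) π.law :=
  .of_bound ((continuous_augCost (continuous_of_abs_sub_le hφ) t).measurable.comp
    (hY.prodMk (by fun_prop))).aestronglyMeasurable |L| (.of_forall fun ω => abs_augCost_le hφ _ _ _)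

theorem Policy.ae_action_eq (π : M.Policy) (t : Fin (T + 1)) {h : History Ξ t → M.A t}
    (hh : Measurable h) (hπ : π.kernel t = Kernel.deterministic h hh) :
    ∀ᵐ ω ∂π.law, ω.2 t = h (historyOf t ω.1) := by
  refine Measure.ae_compProd_of_ae_ae (measurableSet_eq_fun (by fun_prop)
    (hh.comp ((measurable_historyOf t).comp measurable_fst))) (.of_forall fun ξ => ?_)
  have h1 : ∀ᵐ a ∂π.kernel t (historyOf t ξ), a = h (historyOf t ξ) := by
    rw [hπ, Kernel.deterministic_apply, ae_dirac_eq]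
    exact rfl
  exact (measurePreserving_eval (fun t => π.kernel t (historyOf t ξ)) t).quasiMeasurePreserving.ae h1

/-! ### Feedback trajectories -/

theorem Feedback.closedLoop_succ (g : M.Feedback) (s : M.S 0) (i : Fin T)
    (η : History Ξ i.succ) :
    g.closedLoop s i.succ η =
      M.augStep i (g.closedLoop s i.castSucc fun j => η ⟨j, j.2.trans i.castSucc_lt_succ⟩)
        (g.act i.castSucc (g.closedLoop s i.castSucc fun j =>
          η ⟨j, j.2.trans i.castSucc_lt_succ⟩)) (η ⟨i, i.castSucc_lt_succ⟩) := by
  simp [closedLoop]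

/-- The augmented state under the feedback rule `g` restarted from `z t` at stage `t`; before
stage `t` it is pinned to `z`. -/
def Feedback.closedLoopFrom (g : M.Feedback) (t : Fin (T + 1)) (z : ∀ j, M.S j × ℝ) :
    ∀ j : Fin (T + 1), History Ξ j → M.S j × ℝ :=
  Fin.induction (motive := fun j => History Ξ j → M.S j × ℝ)
    (fun _ => z 0)
    (fun i p η =>
      if i.succ ≤ t then z i.succ else
        let y := p fun j => η ⟨j, j.2.trans i.castSucc_lt_succ⟩
        M.augStep i y (g.act i.castSucc y) (η ⟨i, i.castSucc_lt_succ⟩))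

theorem Feedback.closedLoopFrom_succ (g : M.Feedback) (t : Fin (T + 1)) (z : ∀ j, M.S j × ℝ)
    (i : Fin T) (η : History Ξ i.succ) :
    g.closedLoopFrom t z i.succ η = if i.succ ≤ t then z i.succ else
      M.augStep i (g.closedLoopFrom t z i.castSucc fun j => η ⟨j, j.2.trans i.castSucc_lt_succ⟩)
        (g.act i.castSucc
          (g.closedLoopFrom t z i.castSucc fun j => η ⟨j, j.2.trans i.castSucc_lt_succ⟩))
        (η ⟨i, i.castSucc_lt_succ⟩) := by
  simp [closedLoopFrom]

theorem Feedback.closedLoopFrom_self (g : M.Feedback) (t : Fin (T + 1)) (z : ∀ j, M.S j × ℝ)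
    (η : History Ξ t) : g.closedLoopFrom t z t η = z t := by
  induction t using Fin.cases with
  | zero => rfl
  | succ i => rw [closedLoopFrom_succ, if_pos le_rfl]

theorem nonempty_state (s : M.S 0) (t : Fin (T + 1)) : Nonempty (M.S t) := by
  have : ∀ i, Nonempty (Ξ i) := fun i => nonempty_of_isProbabilityMeasure (M.P i)
  exact ⟨M.state s (fun i => Classical.arbitrary _, fun j => Classical.arbitrary _) t⟩

/-! ### One step of the recursion along a trajectory -/

variable [∀ t, BorelSpace (Ξ t)]

theorem measurable_tailCost_comp (hφ : Continuous φ) (t : Fin (T + 1))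
    {Y : (∀ j, Ξ j) × (∀ t, M.A t) → M.S t × ℝ} (hY : Measurable Y) :
    Measurable fun ω => M.tailCost φ ω t (Y ω) :=
  (measurable_tailCost hφ t).comp (measurable_id.prodMk hY)

theorem Policy.integrable_tailCost (hφ : ∀ z z', |φ z - φ z'| ≤ L * |z - z'|) (π : M.Policy)
    (t : Fin (T + 1)) {Y : (∀ j, Ξ j) × (∀ t, M.A t) → M.S t × ℝ} (hY : Measurable Y) :
    Integrable (fun ω => M.tailCost φ ω t (Y ω)) π.law := by
  obtain ⟨C, hC⟩ := exists_abs_tailCost_le (M := M) hφ t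
  exact .of_bound (measurable_tailCost_comp
    (continuous_of_abs_sub_le hφ) t hY).aestronglyMeasurable C (.of_forall fun ω => hC _ _)

theorem Policy.integrable_bellmanValue (hφ : ∀ z z', |φ z - φ z'| ≤ L * |z - z'|) (π : M.Policy)
    (t : Fin (T + 1)) {Y : (∀ j, Ξ j) × (∀ t, M.A t) → M.S t × ℝ} (hY : Measurable Y) :
    Integrable (fun ω => M.bellmanValue φ t (Y ω)) π.law := by
  obtain ⟨-, hG, C, hC⟩ := bellmanValue_regular (M := M) hφ t
  exact .of_bound (hG.measurable.comp hY).aestronglyMeasurable C (.of_forall fun ω => hC _)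

theorem Policy.integrable_bellmanObjective (hφ : ∀ z z', |φ z - φ z'| ≤ L * |z - z'|)
    (π : M.Policy) (i : Fin T) {Y : (∀ j, Ξ j) × (∀ t, M.A t) → M.S i.castSucc × ℝ}
    (hY : Measurable Y) :
    Integrable (fun ω => M.bellmanObjective φ (M.bellmanValue φ) i.castSucc (Y ω)
      (ω.2 i.castSucc)) π.law := by
  obtain ⟨-, -, C, hC⟩ := bellmanValue_regular (M := M) hφ i.succ
  refine .of_bound (((bellmanValue_regular (M := M) hφ i.castSucc).1.measurable.comp
    (hY.prodMk (by fun_prop : Measurable fun ω : (∀ j, Ξ j) × (∀ t, M.A t) =>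
      ω.2 i.castSucc))).aestronglyMeasurable) (|L| + C) (.of_forall fun ω => ?_)
  rw [bellmanObjective_castSucc]
  refine (abs_add_le _ _).trans (add_le_add (abs_augCost_le hφ _ _ _) ?_)
  simpa using norm_integral_le_of_norm_le_const (μ := M.P i)
    (f := fun ξ => M.bellmanValue φ i.succ (M.augStep i (Y ω) (ω.2 i.castSucc) ξ))
    (.of_forall fun ξ => hC _)

/-- One step of the Bellman recursion along a random augmented state that depends on the past. -/
theorem Policy.integral_augCost_add_bellmanValue (hφ : ∀ z z', |φ z - φ z'| ≤ L * |z - z'|)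
    (π : M.Policy) (i : Fin T) {Y : History Ξ i.castSucc ×
      (∀ j : {j : Fin (T + 1) // j < i.castSucc}, M.A j) → M.S i.castSucc × ℝ}
    (hY : Measurable Y) :
    (∫ ω, M.augCost φ i.castSucc (Y (historyOf _ ω.1, controlsOf _ ω.2)) (ω.2 i.castSucc) ∂π.law) +
      ∫ ω, M.bellmanValue φ i.succ (M.augStep i (Y (historyOf _ ω.1, controlsOf _ ω.2))
        (ω.2 i.castSucc) (ω.1 i)) ∂π.law =
    ∫ ω, M.bellmanObjective φ (M.bellmanValue φ) i.castSucc
      (Y (historyOf _ ω.1, controlsOf _ ω.2)) (ω.2 i.castSucc) ∂π.law := by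
  obtain ⟨-, hG, C, hC⟩ := bellmanValue_regular (M := M) hφ i.succ
  have hY' : Measurable fun ω : (∀ j, Ξ j) × (∀ t, M.A t) =>
      Y (historyOf i.castSucc ω.1, controlsOf i.castSucc ω.2) :=
    hY.comp (((measurable_historyOf _).comp measurable_fst).prodMk
      ((measurable_controlsOf _).comp measurable_snd))
  -- The pair of current state and current control depends on `A_0, …, A_i` but on no noise beyond
  -- `ξ_{i-1}`, so `integral_noise` applies to it.
  have hZ : Measurable fun p : History Ξ i.castSucc ×
      (∀ j : {j : Fin (T + 1) // j < i.succ}, M.A j) =>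
      (Y (p.1, fun j => p.2 ⟨j, j.2.trans i.castSucc_lt_succ⟩),
        p.2 ⟨i.castSucc, i.castSucc_lt_succ⟩) := by
    refine (hY.comp (measurable_fst.prodMk (measurable_pi_lambda _ fun j => ?_))).prodMk ?_
    · exact (measurable_pi_apply _).comp measurable_snd
    · exact (measurable_pi_apply _).comp measurable_snd
  have h := π.integral_noise i hZ
    (G := fun p => M.bellmanValue φ i.succ (M.augStep i p.1.1 p.1.2 p.2))
    (hG.measurable.comp (measurable_augStep i)) fun p => hC _
  have h2 : ∀ ω : (∀ j, Ξ j) × (∀ t, M.A t),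
      ∫ ξ, M.bellmanValue φ i.succ (M.augStep i (Y (historyOf i.castSucc ω.1,
        controlsOf i.castSucc ω.2)) (ω.2 i.castSucc) ξ) ∂M.P i =
      M.bellmanObjective φ (M.bellmanValue φ) i.castSucc
        (Y (historyOf i.castSucc ω.1, controlsOf i.castSucc ω.2)) (ω.2 i.castSucc) -
      M.augCost φ i.castSucc (Y (historyOf i.castSucc ω.1, controlsOf i.castSucc ω.2))
        (ω.2 i.castSucc) := fun ω => by
    rw [bellmanObjective_castSucc, add_sub_cancel_left]
  have h3 : ∫ ω, M.bellmanValue φ i.succ (M.augStep i (Y (historyOf i.castSucc ω.1,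
        controlsOf i.castSucc ω.2)) (ω.2 i.castSucc) (ω.1 i)) ∂π.law =
      ∫ ω, ∫ ξ, M.bellmanValue φ i.succ (M.augStep i (Y (historyOf i.castSucc ω.1,
        controlsOf i.castSucc ω.2)) (ω.2 i.castSucc) ξ) ∂M.P i ∂π.law := h
  rw [h3, integral_congr_ae (.of_forall h2), integral_sub
    (π.integrable_bellmanObjective hφ i hY') (π.integrable_augCost hφ _ hY'), add_sub_cancel]

/-! ### The Bellman value is a lower bound -/

/-- A fixed starting state becomes random after one step, so the induction runs over all states that
are measurable functions of past noises and controls. Each step bounds the value by the objective at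
the control actually taken. -/
theorem Policy.integral_bellmanValue_le (hφ : ∀ z z', |φ z - φ z'| ≤ L * |z - z'|) (π : M.Policy)
    (t : Fin (T + 1)) {Y : History Ξ t × (∀ j : {j : Fin (T + 1) // j < t}, M.A j) → M.S t × ℝ}
    (hY : Measurable Y) :
    ∫ ω, M.bellmanValue φ t (Y (historyOf _ ω.1, controlsOf _ ω.2)) ∂π.law ≤
      ∫ ω, M.tailCost φ ω t (Y (historyOf _ ω.1, controlsOf _ ω.2)) ∂π.law := by
  have hpast : ∀ t, Measurable fun ω : (∀ j, Ξ j) × (∀ t, M.A t) =>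
      (historyOf t ω.1, controlsOf t ω.2) := fun t =>
    ((measurable_historyOf _).comp measurable_fst).prodMk
      ((measurable_controlsOf _).comp measurable_snd)
  induction t using Fin.reverseInduction with
  | last =>
    refine integral_mono (π.integrable_bellmanValue hφ _ (hY.comp (hpast _)))
      (π.integrable_tailCost hφ _ (hY.comp (hpast _))) fun ω => ?_
    have := (isLeast_bellmanValue hφ (Fin.last T)
      (Y (historyOf _ ω.1, controlsOf _ ω.2))).2 ⟨ω.2 (Fin.last T), rfl⟩
    simpa only [bellmanObjective_last, tailCost_last] using this
  | cast i ih =>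
    -- The next augmented state, as a function of the past enlarged by `ξ_i` and `A_i`, is the
    -- starting state for the induction hypothesis.
    have hZ : Measurable fun p : History Ξ i.succ ×
        (∀ j : {j : Fin (T + 1) // j < i.succ}, M.A j) =>
        M.augStep i (Y (fun j => p.1 ⟨j, j.2.trans i.castSucc_lt_succ⟩,
          fun j => p.2 ⟨j, j.2.trans i.castSucc_lt_succ⟩))
          (p.2 ⟨i.castSucc, i.castSucc_lt_succ⟩) (p.1 ⟨i, i.castSucc_lt_succ⟩) := by
      refine (measurable_augStep i).comp (((hY.comp (Measurable.prodMk ?_ ?_)).prodMk ?_).prodMk ?_)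
      · exact measurable_pi_lambda _ fun j => (measurable_pi_apply _).comp measurable_fst
      · exact measurable_pi_lambda _ fun j => (measurable_pi_apply _).comp measurable_snd
      · exact (measurable_pi_apply _).comp measurable_snd
      · exact (measurable_pi_apply _).comp measurable_fst
    have hY' := hY.comp (hpast i.castSucc)
    calc _ ≤ ∫ ω, M.bellmanObjective φ (M.bellmanValue φ) i.castSucc
          (Y (historyOf _ ω.1, controlsOf _ ω.2)) (ω.2 i.castSucc) ∂π.law :=
        integral_mono (π.integrable_bellmanValue hφ _ hY')
          (π.integrable_bellmanObjective hφ i hY') fun ω =>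
            (isLeast_bellmanValue hφ i.castSucc _).2 ⟨ω.2 i.castSucc, rfl⟩
      _ = _ := (π.integral_augCost_add_bellmanValue hφ i hY).symm
      _ ≤ _ := add_le_add_right (ih hZ) _
      _ = _ := by
        simp only [tailCost_castSucc]
        exact (integral_add (π.integrable_augCost hφ _ hY')
          (π.integrable_tailCost hφ _ (hZ.comp (hpast i.succ)))).symm

theorem Policy.bellmanValue_le_costToGo (hφ : ∀ z z', |φ z - φ z'| ≤ L * |z - z'|) (π : M.Policy)
    (t : Fin (T + 1)) (y : M.S t × ℝ) : M.bellmanValue φ t y ≤ M.costToGo φ π t y := by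
  simpa [costToGo] using π.integral_bellmanValue_le hφ t (Y := fun _ => y) measurable_const

/-! ### Greedy policies attain the Bellman value -/

/-- The lower-bound induction with equalities, since the control is almost surely a minimizer. The
trajectory `Y` is abstract and follows the dynamics only from stage `t` on, which covers both the
closed loop from `(s, 0)` and restarts at an arbitrary `(t, y)`. -/
theorem Policy.costToGo_eq_bellmanValue (hφ : ∀ z z', |φ z - φ z'| ≤ L * |z - z'|) (π : M.Policy)
    (g : M.Feedback) (hg : ∀ t y, M.bellmanObjective φ (M.bellmanValue φ) t y (g.act t y) =
      M.bellmanValue φ t y)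
    (t : Fin (T + 1)) (y : M.S t × ℝ) (Y : ∀ j, History Ξ j → M.S j × ℝ)
    (hY : ∀ j, Measurable (Y j)) (hYt : ∀ η, Y t η = y)
    (hstep : ∀ i : Fin T, t ≤ i.castSucc → ∀ ξ : ∀ j, Ξ j, Y i.succ (historyOf _ ξ) =
      M.augStep i (Y i.castSucc (historyOf _ ξ)) (g.act _ (Y i.castSucc (historyOf _ ξ))) (ξ i))
    (hπ : ∀ j, π.kernel j = Kernel.deterministic (fun η => g.act j (Y j η))
      ((g.measurable_act j).comp (hY j))) :
    M.costToGo φ π t y = M.bellmanValue φ t y := by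
  have hYω : ∀ j, Measurable fun ω : (∀ j, Ξ j) × (∀ t, M.A t) => Y j (historyOf j ω.1) :=
    fun j => (hY j).comp ((measurable_historyOf j).comp measurable_fst)
  have key : ∀ j, t ≤ j → ∫ ω, M.tailCost φ ω j (Y j (historyOf j ω.1)) ∂π.law =
      ∫ ω, M.bellmanValue φ j (Y j (historyOf j ω.1)) ∂π.law := by
    intro j
    induction j using Fin.reverseInduction with
    | last =>
      intro _
      refine integral_congr_ae ?_
      filter_upwards [π.ae_action_eq _ _ (hπ (Fin.last T))] with ω hω
      rw [tailCost_last, hω, ← hg, bellmanObjective_last]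
    | cast i ih =>
      intro hti
      have hae := π.ae_action_eq _ _ (hπ i.castSucc)
      have hae' : ∀ᵐ ω ∂π.law, M.augStep i (Y i.castSucc (historyOf _ ω.1)) (ω.2 i.castSucc)
          (ω.1 i) = Y i.succ (historyOf _ ω.1) := by
        filter_upwards [hae] with ω hω
        rw [hω, hstep i hti]
      have hae1 : ∀ᵐ ω ∂π.law, M.bellmanValue φ i.succ (M.augStep i
          (Y i.castSucc (historyOf _ ω.1)) (ω.2 i.castSucc) (ω.1 i)) =
          M.bellmanValue φ i.succ (Y i.succ (historyOf _ ω.1)) := by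
        filter_upwards [hae'] with ω hω
        rw [hω]
      have hae2 : ∀ᵐ ω ∂π.law, M.tailCost φ ω i.castSucc (Y i.castSucc (historyOf _ ω.1)) =
          M.augCost φ i.castSucc (Y i.castSucc (historyOf _ ω.1)) (ω.2 i.castSucc) +
            M.tailCost φ ω i.succ (Y i.succ (historyOf _ ω.1)) := by
        filter_upwards [hae'] with ω hω
        rw [tailCost_castSucc, hω]
      have hae3 : ∀ᵐ ω ∂π.law, M.bellmanObjective φ (M.bellmanValue φ) i.castSucc
          (Y i.castSucc (historyOf _ ω.1)) (ω.2 i.castSucc) =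
          M.bellmanValue φ i.castSucc (Y i.castSucc (historyOf _ ω.1)) := by
        filter_upwards [hae] with ω hω
        rw [hω, hg]
      rw [integral_congr_ae hae2, integral_add (π.integrable_augCost hφ _ (hYω _))
        (π.integrable_tailCost hφ _ (hYω _)), ih (hti.trans i.castSucc_lt_succ.le),
        ← integral_congr_ae hae1, ← integral_congr_ae hae3]
      exact π.integral_augCost_add_bellmanValue hφ i ((hY i.castSucc).comp measurable_fst)
  simpa [hYt, costToGo] using key t le_rfl

theorem Feedback.costToGo_toPolicy (hφ : ∀ z z', |φ z - φ z'| ≤ L * |z - z'|)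
    (g : M.Feedback) (hg : ∀ t y, M.bellmanObjective φ (M.bellmanValue φ) t y (g.act t y) =
      M.bellmanValue φ t y) (s : M.S 0) :
    M.costToGo φ (g.toPolicy s) 0 (s, 0) = M.bellmanValue φ 0 (s, 0) :=
  (g.toPolicy s).costToGo_eq_bellmanValue hφ g hg 0 (s, 0) (g.closedLoop s)
    (g.measurable_closedLoop s) (fun _ => rfl) (fun i _ _ => g.closedLoop_succ s i _)
    fun _ => rfl

theorem Feedback.measurable_closedLoopFrom (g : M.Feedback) (t : Fin (T + 1))
    (z : ∀ j, M.S j × ℝ) (j : Fin (T + 1)) : Measurable (g.closedLoopFrom t z j) := by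
  induction j using Fin.induction with
  | zero => exact measurable_const
  | succ i ih =>
    rw [funext (g.closedLoopFrom_succ t z i)]
    split_ifs
    · exact measurable_const
    · have h1 : Measurable fun η : History Ξ i.succ => g.closedLoopFrom t z i.castSucc
          fun j => η ⟨j, j.2.trans i.castSucc_lt_succ⟩ :=
        ih.comp (measurable_pi_lambda _ fun j => measurable_pi_apply _)
      exact (measurable_augStep i).comp
        ((h1.prodMk ((g.measurable_act i.castSucc).comp h1)).prodMk (measurable_pi_apply _))

/-- The initial state `s` serves only to make every state space nonempty, so that the restarted
trajectory can be given values before stage `t`. -/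
theorem isLeast_costToGo (hφ : ∀ z z', |φ z - φ z'| ≤ L * |z - z'|) (s : M.S 0)
    (t : Fin (T + 1)) (y : M.S t × ℝ) :
    IsLeast (Set.range fun π : M.Policy => M.costToGo φ π t y) (M.bellmanValue φ t y) := by
  classical
  refine ⟨?_, ?_⟩
  · obtain ⟨g, hg⟩ := exists_feedback_bellman (M := M) hφ
    have := nonempty_state s
    -- Only the value at `t` matters: earlier ones affect only controls that the cost from stage `t`
    -- ignores, and later ones are never read.
    let z : ∀ j, M.S j × ℝ := Function.update (fun j => (Classical.arbitrary _, 0)) t y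
    let π : M.Policy :=
      { kernel := fun j => Kernel.deterministic (fun η => g.act j (g.closedLoopFrom t z j η))
          ((g.measurable_act j).comp (g.measurable_closedLoopFrom t z j))
        isMarkov := fun _ => inferInstance }
    refine ⟨π, π.costToGo_eq_bellmanValue hφ g hg t y (g.closedLoopFrom t z)
      (g.measurable_closedLoopFrom t z) (fun η => ?_) (fun i hi _ => ?_) fun _ => rfl⟩
    · rw [Feedback.closedLoopFrom_self, show z t = y from Function.update_self ..]
    · rw [Feedback.closedLoopFrom_succ, if_neg (hi.trans_lt i.castSucc_lt_succ).not_ge]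
      rfl
  · rintro _ ⟨π, rfl⟩
    exact π.bellmanValue_le_costToGo hφ t y

theorem optCostToGo_eq_bellmanValue (hφ : ∀ z z', |φ z - φ z'| ≤ L * |z - z'|) (s : M.S 0) :
    M.optCostToGo φ = M.bellmanValue φ :=
  funext fun t => funext fun y => (isLeast_costToGo hφ s t y).csInf_eq

/-! ### Minimizing the risk -/

theorem value_eq_costToGo_add (f : EuclideanSpace ℝ (Fin d) → ℝ → ℝ) (θ : EuclideanSpace ℝ (Fin d))
    (hf : ∀ z z', |f θ z - f θ z'| ≤ L * |z - z'|) (π : M.Policy) (s : M.S 0) :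
    M.value f π θ s = M.costToGo (f θ) π 0 (s, 0) + f θ 0 := by
  simp only [value, totalCost_eq_tailCost, costToGo]
  rw [integral_add (π.integrable_tailCost hf 0 measurable_const) (integrable_const _)]
  simp

theorem isLeast_value (f : EuclideanSpace ℝ (Fin d) → ℝ → ℝ) (θ : EuclideanSpace ℝ (Fin d))
    (hf : ∀ z z', |f θ z - f θ z'| ≤ L * |z - z'|) (s : M.S 0) :
    IsLeast (Set.range fun π : M.Policy => M.value f π θ s)
      (M.bellmanValue (f θ) 0 (s, 0) + f θ 0) := by
  simp only [value_eq_costToGo_add f θ hf]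
  obtain ⟨⟨π, hπ⟩, h⟩ := isLeast_costToGo hf s 0 (s, 0)
  refine ⟨⟨π, by simpa using hπ⟩, ?_⟩
  rintro _ ⟨π', rfl⟩
  exact add_le_add_left (h ⟨π', rfl⟩) _

/-- The lower bound is the optimality of `θstar` among parameters; the upper bound holds because
`θstar` competes in the infimum. A policy optimal for `f θstar` makes the two meet. -/
theorem risk_bounds {Θ : Set (EuclideanSpace ℝ (Fin d))} {f : EuclideanSpace ℝ (Fin d) → ℝ → ℝ}
    (hf : ∀ θ ∈ Θ, ∀ z z' : ℝ, |f θ z - f θ z'| ≤ L * |z - z'|) (s : M.S 0)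
    {θstar : EuclideanSpace ℝ (Fin d)} (hθstar : θstar ∈ Θ)
    (hopt : ∀ θ ∈ Θ, (⨅ π : M.Policy, M.value f π θstar s) ≤ ⨅ π : M.Policy, M.value f π θ s)
    (π : M.Policy) :
    M.bellmanValue (f θstar) 0 (s, 0) + f θstar 0 ≤ M.risk Θ f s π ∧
      M.risk Θ f s π ≤ M.value f π θstar s := by
  have hle : ∀ θ : Θ, M.bellmanValue (f θstar) 0 (s, 0) + f θstar 0 ≤ M.value f π θ s := by
    intro θ
    have h := hopt θ θ.2
    rw [iInf, (isLeast_value f θstar (hf _ hθstar) s).csInf_eq, iInf,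
      (isLeast_value f θ (hf θ θ.2) s).csInf_eq] at h
    exact h.trans ((isLeast_value f θ (hf θ θ.2) s).2 ⟨π, rfl⟩)
  have : Nonempty Θ := ⟨⟨θstar, hθstar⟩⟩
  -- `hle` also supplies the lower bound without which the real infimum over `Θ` would be a default
  -- value.
  exact ⟨le_ciInf hle, ciInf_le ⟨_, Set.forall_mem_range.mpr hle⟩ (⟨θstar, hθstar⟩ : Θ)⟩

end FiniteSOC

end

theorem mainTheorem11 {T dS dA d : ℕ} {Ξ : Fin T → Type*} [∀ t, TopologicalSpace (Ξ t)]
    [∀ t, MeasurableSpace (Ξ t)] [∀ t, BorelSpace (Ξ t)] (M : FiniteSOC T dS dA Ξ)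
    (Θ : Set (EuclideanSpace ℝ (Fin d))) (f : EuclideanSpace ℝ (Fin d) → ℝ → ℝ)
    (L_C L_Θ R_Θ : ℝ)
    (hfC : ∀ θ ∈ Θ, ∀ z z' : ℝ, |f θ z - f θ z'| ≤ L_C * |z - z'|)
    (hfΘ : ∀ θ ∈ Θ, ∀ θ' ∈ Θ, ∀ z : ℝ, |f θ z - f θ' z| ≤ L_Θ * ‖θ - θ'‖)
    (hΘ : ∀ θ ∈ Θ, ‖θ‖ ≤ R_Θ)
    (s : M.S 0)
    (θstar : EuclideanSpace ℝ (Fin d)) (hθstar : θstar ∈ Θ)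
    (hopt : ∀ θ ∈ Θ, (⨅ π : M.Policy, M.value f π θstar s) ≤ ⨅ π : M.Policy, M.value f π θ s) :
    -- the optimal cost-to-go functions are attained minima over the policies
    (∀ (t : Fin (T + 1)) (y : M.S t × ℝ),
      IsLeast (Set.range fun π : M.Policy => M.costToGo (f θstar) π t y)
        (M.optCostToGo (f θstar) t y)) ∧
    -- dynamic programming equations
    (∀ (i : Fin T) (y : M.S i.castSucc × ℝ) (a : M.A i.castSucc),
      MeasureTheory.Integrable
        (fun ξ => M.optCostToGo (f θstar) i.succ (M.augStep i y a ξ)) (M.P i)) ∧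
    (∀ (t : Fin (T + 1)) (y : M.S t × ℝ),
      IsLeast (Set.range fun a : M.A t => M.dpObjective (f θstar) t y a)
        (M.optCostToGo (f θstar) t y)) ∧
    -- the optimal risk
    IsLeast (Set.range fun π : M.Policy => M.risk Θ f s π)
      (M.optCostToGo (f θstar) 0 (s, 0) + f θstar 0) ∧
    -- greedy policies exist, and each of them is optimal
    (∃ g : M.Feedback, g.IsGreedy (f θstar)) ∧
    (∀ g : M.Feedback, g.IsGreedy (f θstar) →
      ∀ π : M.Policy, M.risk Θ f s (g.toPolicy s) ≤ M.risk Θ f s π) := by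
  have hf := hfC θstar hθstar
  have hV := FiniteSOC.optCostToGo_eq_bellmanValue hf s
  have hbounds := FiniteSOC.risk_bounds hfC s hθstar hopt
  -- Since the minimum is attained and equals the Bellman value, being a minimizer is the same as
  -- attaining that value.
  have hgreedy : ∀ g : M.Feedback, g.IsGreedy (f θstar) ↔
      ∀ t y, M.bellmanObjective (f θstar) (M.bellmanValue (f θstar)) t y (g.act t y) =
        M.bellmanValue (f θstar) t y := fun g => by
    simp only [FiniteSOC.Feedback.IsGreedy, FiniteSOC.dpObjective_eq_bellmanObjective, hV]
    refine forall_congr' fun t => forall_congr' fun y => ?_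
    have hle := FiniteSOC.isLeast_bellmanValue hf t y
    refine ⟨fun h => le_antisymm ?_ (hle.2 ⟨_, rfl⟩), fun h a => h.trans_le (hle.2 ⟨a, rfl⟩)⟩
    obtain ⟨a, ha⟩ := hle.1
    exact (h a).trans ha.le
  have hrisk : ∀ g : M.Feedback, g.IsGreedy (f θstar) → M.risk Θ f s (g.toPolicy s) =
      M.bellmanValue (f θstar) 0 (s, 0) + f θstar 0 := fun g hg => by
    refine le_antisymm ((hbounds _).2.trans_eq ?_) (hbounds _).1
    rw [FiniteSOC.value_eq_costToGo_add f θstar hf, g.costToGo_toPolicy hf ((hgreedy g).mp hg)]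
  obtain ⟨g₀, hg₀⟩ := FiniteSOC.exists_feedback_bellman (M := M) hf
  rw [← hgreedy] at hg₀
  rw [FiniteSOC.dpObjective_eq_bellmanObjective, hV]
  refine ⟨FiniteSOC.isLeast_costToGo hf s, FiniteSOC.integrable_bellmanValue_augStep hf,
    FiniteSOC.isLeast_bellmanValue hf, ⟨⟨g₀.toPolicy s, hrisk g₀ hg₀⟩, ?_⟩, ⟨g₀, hg₀⟩,
    fun g hg π => (hrisk g hg).trans_le (hbounds π).1⟩
  rintro _ ⟨π, rfl⟩
  exact (hbounds π).1
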